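/- Let $(B,g)$ be a connected smooth Riemannian surface, let $(F,\ddot g)$ be a non-empty smooth Riemannian surface that is Ricci-flat, and let $f\colon B\to(0,\infty)$ be a smooth positive function. Assume that the scalar curvature of $(B,g)$ is a constant multiple of $f$, that is, $R_B=c\,f$ on $B$ for some constant $c\in\mathbb R$. If the warped product $B\times_f F$, that is, the $4$-manifold $B\times F$ with the metric $\bar g=\pi_B^*g+(f\circ\pi_B)^2\,\pi_F^*\ddot g$ (where $\pi_B,\pi_F$ are the projections), is Ricci-flat, then $f$ is constant and $(B,g)$ is flat, i.e. its Riemann curvature tensor vanishes. -/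

import Mathlib

open scoped Manifold ContDiff Bundle

noncomputable section

namespace WarpedSurface

section Local

/-! Curvature of a field `G` of symmetric bilinear forms on a finite-dimensional real vector space
`E` (the coordinate space of a chart), written without choosing a basis of `E`. -/

variable {E : Type*} [NormedAddCommGroup E] [NormedSpace ℝ E]

/-- The pullback `(v, w) ↦ β (A v) (A w)` of a bilinear form `β` by a linear map `A`. -/
def pullbackForm {E' : Type*} [NormedAddCommGroup E'] [NormedSpace ℝ E']
    (A : E →L[ℝ] E') (β : E' →L[ℝ] E' →L[ℝ] ℝ) : E →L[ℝ] E →L[ℝ] ℝ :=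
  β.bilinearComp A A

/-- Christoffel symbols of the first kind: the linear form
`u ↦ ½ (∂ᵥ G(w, u) + ∂_w G(v, u) - ∂ᵤ G(v, w))`. -/
def christoffelFirst (G : E → E →L[ℝ] E →L[ℝ] ℝ) (y v w : E) : E →L[ℝ] ℝ :=
  (2⁻¹ : ℝ) • (fderiv ℝ (fun z => G z w) y v + fderiv ℝ (fun z => G z v) y w
    - fderiv ℝ (fun z => G z v w) y)

/-- Christoffel symbols of the second kind: `Γ(v, w)` is the vector with
`G(Γ(v, w), u) = ½ (∂ᵥ G(w, u) + ∂_w G(v, u) - ∂ᵤ G(v, w))` for all `u`; here `G y`, seen as a map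
from `E` to its dual, is inverted. -/
def christoffel (G : E → E →L[ℝ] E →L[ℝ] ℝ) (y v w : E) : E :=
  (G y).inverse (christoffelFirst G y v w)

/-- The Riemann curvature
`R(u, v) w = ∂ᵤ Γ(v, w) - ∂ᵥ Γ(u, w) + Γ(u, Γ(v, w)) - Γ(v, Γ(u, w))`. -/
def riemann (G : E → E →L[ℝ] E →L[ℝ] ℝ) (y u v w : E) : E :=
  fderiv ℝ (fun z => christoffel G z v w) y u - fderiv ℝ (fun z => christoffel G z u w) y v
    + christoffel G y u (christoffel G y v w) - christoffel G y v (christoffel G y u w)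

/-- The Ricci curvature `Ric(v, w) = tr (u ↦ R(u, v) w)`; the trace is computed in a basis. -/
def ricci [FiniteDimensional ℝ E] (G : E → E →L[ℝ] E →L[ℝ] ℝ) (y v w : E) : ℝ :=
  ∑ i, (Module.finBasis ℝ E).coord i (riemann G y (Module.finBasis ℝ E i) v w)

/-- The scalar curvature `∑ᵢⱼ Gⁱʲ Ric(bᵢ, bⱼ)` in a basis `b`, where
`Gⁱʲ = bⁱ (G⁻¹ bʲ)` are the entries of the inverse matrix of `G`. -/
def scalar [FiniteDimensional ℝ E] (G : E → E →L[ℝ] E →L[ℝ] ℝ) (y : E) : ℝ :=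
  ∑ i, ∑ j, (Module.finBasis ℝ E).coord i
      ((G y).inverse ((Module.finBasis ℝ E).coord j).toContinuousLinearMap) *
    ricci G y (Module.finBasis ℝ E i) (Module.finBasis ℝ E j)

end Local

section Global

variable {E : Type*} [NormedAddCommGroup E] [NormedSpace ℝ E]
  {H : Type*} [TopologicalSpace H] (I : ModelWithCorners ℝ E H)
  {M : Type*} [TopologicalSpace M] [ChartedSpace H M]

/-- A field of continuous bilinear forms on the tangent spaces of `M`. -/
abbrev FormField (M : Type*) [TopologicalSpace M] [ChartedSpace H M] :=
  ∀ x : M, TangentSpace I x →L[ℝ] TangentSpace I x →L[ℝ] ℝ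

variable {I}

/-- The coordinate expression of `g` in the chart `e`: the pullback of `g` by the inverse of the
chart. It is meaningful on the target of the chart, which is open in `E` when `I` has no boundary
(the only case in which this is used). -/
def inChart (g : FormField I M) (e : OpenPartialHomeomorph M H) (y : E) : E →L[ℝ] E →L[ℝ] ℝ :=
  pullbackForm (E := E) (E' := E) (mfderiv 𝓘(ℝ, E) I (e.extend I).symm y) (g ((e.extend I).symm y))

/-- `Ric = 0`, expressed in every chart of the atlas. -/
def IsRicciFlat [FiniteDimensional ℝ E] (g : FormField I M) : Prop :=
  ∀ e ∈ atlas H M, ∀ y ∈ (e.extend I).target, ∀ v w, ricci (inChart g e) y v w = 0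

/-- The Riemann curvature tensor vanishes, expressed in every chart of the atlas. -/
def IsFlat (g : FormField I M) : Prop :=
  ∀ e ∈ atlas H M, ∀ y ∈ (e.extend I).target, ∀ u v w, riemann (inChart g e) y u v w = 0

/-- The scalar curvature of `g` is the function `ρ`, expressed in every chart of the atlas. -/
def HasScalarCurvature [FiniteDimensional ℝ E] (g : FormField I M) (ρ : M → ℝ) : Prop :=
  ∀ e ∈ atlas H M, ∀ y ∈ (e.extend I).target,
    scalar (inChart g e) y = ρ ((e.extend I).symm y)

/-- The warped product metric `π_B^* g + (f ∘ π_B)² π_F^* k` on `B × F`. -/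
def warped {E' : Type*} [NormedAddCommGroup E'] [NormedSpace ℝ E']
    {H' : Type*} [TopologicalSpace H'] {J : ModelWithCorners ℝ E' H'}
    {B : Type*} [TopologicalSpace B] [ChartedSpace H B]
    {F : Type*} [TopologicalSpace F] [ChartedSpace H' F]
    (g : FormField I B) (f : B → ℝ) (k : FormField J F) : FormField (I.prod J) (B × F) :=
  fun p =>
    (pullbackForm (E := E × E') (E' := E) (mfderiv (I.prod J) I Prod.fst p) (g p.1) +
      (f p.1) ^ 2 •
        pullbackForm (E := E × E') (E' := E') (mfderiv (I.prod J) J Prod.snd p) (k p.2) :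
      E × E' →L[ℝ] E × E' →L[ℝ] ℝ)

end Global

end WarpedSurface

end

/-!
Write `m` for the dimension of the fiber and `R` for the scalar curvature of the base. The
horizontal part of `Ric = 0` for the warped product is `φ Ric_B = m ∇²φ`. On a surface
`2 Ric_B = R g`, so `∇²φ = (φ R / 2m) g`, which for `R = c φ` gives `Δφ = (c / m) φ²` and
`d|∇φ|² = (c / m) φ² dφ`. The vertical part says that the fiber is Einstein with constant
`λ = φ Δφ + (m - 1) |∇φ|²`, that is, `(m - 1) |∇φ|² = λ - (c / m) φ³`. Differentiating and
comparing gives `(m + 2) c φ² dφ = 0`, hence `dφ = 0` if `c ≠ 0`. If `c = 0`, then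
`(m - 1) |∇φ|² = λ ≤ 0`, and `dφ = 0` again. Now `Ric_B = 0`, and on a surface the Ricci curvature
determines the curvature tensor.
-/

noncomputable section

namespace WarpedSurface

open scoped Topology

set_option maxSynthPendingDepth 3

section LeviCivita

variable {E : Type*} [NormedAddCommGroup E] [NormedSpace ℝ E]

/-- `G` is the coordinate expression of a smooth pseudo-Riemannian metric on the open set `U`:
nondegeneracy is invertibility of `G y` as a map to the dual space. -/
structure IsPseudoRiemannianOn (G : E → E →L[ℝ] E →L[ℝ] ℝ) (U : Set E) : Prop where
  isOpen : IsOpen U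
  contDiffOn : ContDiffOn ℝ ∞ G U
  symm : ∀ y ∈ U, ∀ v w, G y v w = G y w v
  isInvertible : ∀ y ∈ U, (G y).IsInvertible

/-- The Christoffel symbols as a continuous bilinear map; `christoffel G y v w` is its value at
`v`, `w` wherever `G` is differentiable. -/
def christoffelMap (G : E → E →L[ℝ] E →L[ℝ] ℝ) (y : E) : E →L[ℝ] E →L[ℝ] E :=
  ContinuousLinearMap.compL ℝ E (E →L[ℝ] ℝ) E (G y).inverse ∘L ((2⁻¹ : ℝ) •
    (fderiv ℝ G y + (fderiv ℝ G y).flip -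
      (ContinuousLinearMap.flipₗᵢ ℝ E E ℝ).toContinuousLinearEquiv ∘L (fderiv ℝ G y).flip))

/-- The Riemann curvature `R(u, v) w` as a continuous trilinear map. -/
def riemannMap (G : E → E →L[ℝ] E →L[ℝ] ℝ) (y : E) : E →L[ℝ] E →L[ℝ] E →L[ℝ] E :=
  let DΓ := fderiv ℝ (christoffelMap G) y
  let ΓΓ := (ContinuousLinearMap.compL ℝ E E E).bilinearComp
    (christoffelMap G y) (christoffelMap G y)
  DΓ - DΓ.flip + ΓΓ - ΓΓ.flip

/-- The gradient of `φ` with respect to `G`. -/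
def grad (G : E → E →L[ℝ] E →L[ℝ] ℝ) (φ : E → ℝ) (y : E) : E :=
  (G y).inverse (fderiv ℝ φ y)

/-- The covariant derivative `u ↦ ∇ᵤ grad φ` of the gradient of `φ`. -/
def covDerivGrad (G : E → E →L[ℝ] E →L[ℝ] ℝ) (φ : E → ℝ) (y : E) : E →L[ℝ] E :=
  fderiv ℝ (grad G φ) y + (christoffelMap G y).flip (grad G φ y)

/-- The Hessian of `φ` with respect to `G`. -/
def hessian (G : E → E →L[ℝ] E →L[ℝ] ℝ) (φ : E → ℝ) (y v w : E) : ℝ :=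
  fderiv ℝ (fderiv ℝ φ) y v w - fderiv ℝ φ y (christoffelMap G y v w)

/-- The Laplacian of `φ` with respect to `G`, the trace of `u ↦ ∇ᵤ grad φ`. -/
def laplacian (G : E → E →L[ℝ] E →L[ℝ] ℝ) (φ : E → ℝ) (y : E) : ℝ :=
  LinearMap.trace ℝ E (covDerivGrad G φ y)

lemma riemannMap_apply (G : E → E →L[ℝ] E →L[ℝ] ℝ) (y u v w : E) :
    riemannMap G y u v w =
      fderiv ℝ (christoffelMap G) y u v w - fderiv ℝ (christoffelMap G) y v u w +
        christoffelMap G y u (christoffelMap G y v w) -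
        christoffelMap G y v (christoffelMap G y u w) := rfl

lemma riemannMap_self (G : E → E →L[ℝ] E →L[ℝ] ℝ) (y u w : E) :
    riemannMap G y u u w = 0 := by
  rw [riemannMap_apply, sub_self, zero_add, sub_self]

variable {G : E → E →L[ℝ] E →L[ℝ] ℝ} {φ : E → ℝ} {U : Set E} {y : E}

namespace IsPseudoRiemannianOn

lemma mem_nhds (hG : IsPseudoRiemannianOn G U) (hy : y ∈ U) : U ∈ 𝓝 y :=
  hG.isOpen.mem_nhds hy

lemma contDiffAt (hG : IsPseudoRiemannianOn G U) (hy : y ∈ U) : ContDiffAt ℝ ∞ G y :=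
  hG.contDiffOn.contDiffAt (hG.mem_nhds hy)

lemma hasFDerivAt (hG : IsPseudoRiemannianOn G U) (hy : y ∈ U) :
    HasFDerivAt G (fderiv ℝ G y) y :=
  ((hG.contDiffAt hy).differentiableAt (by simp)).hasFDerivAt

lemma hasFDerivAt_apply (hG : IsPseudoRiemannianOn G U) (hy : y ∈ U) (v w : E) :
    HasFDerivAt (fun z ↦ G z v w) (((fderiv ℝ G y).flip v).flip w) y := by
  simpa using ((hG.hasFDerivAt hy).clm_apply (hasFDerivAt_const v y)).clm_apply
    (hasFDerivAt_const w y)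

lemma eq_of_forall_apply_eq (hG : IsPseudoRiemannianOn G U) (hy : y ∈ U) {v w : E}
    (hvw : ∀ u, G y v u = G y w u) : v = w :=
  (hG.isInvertible y hy).injective (ContinuousLinearMap.ext hvw)

lemma apply_inverse (hG : IsPseudoRiemannianOn G U) (hy : y ∈ U) (l : E →L[ℝ] ℝ) :
    G y ((G y).inverse l) = l :=
  (hG.isInvertible y hy).self_apply_inverse l

lemma fderiv_symm (hG : IsPseudoRiemannianOn G U) (hy : y ∈ U) (u v w : E) :
    fderiv ℝ G y u v w = fderiv ℝ G y u w v := by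
  have hvw : (fun z ↦ G z v w) =ᶠ[𝓝 y] fun z ↦ G z w v := by
    filter_upwards [hG.mem_nhds hy] with z hz using hG.symm z hz v w
  exact congr($((hG.hasFDerivAt_apply hy v w).unique
    ((hG.hasFDerivAt_apply hy w v).congr_of_eventuallyEq hvw)) u)

lemma christoffel_eq_christoffelMap (hG : IsPseudoRiemannianOn G U) (hy : y ∈ U) (v w : E) :
    christoffel G y v w = christoffelMap G y v w := by
  have hfst (a : E) : HasFDerivAt (fun z ↦ G z a) ((fderiv ℝ G y).flip a) y := by
    simpa using (hG.hasFDerivAt hy).clm_apply (hasFDerivAt_const a y)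
  simp only [christoffel, christoffelFirst, (hfst v).fderiv, (hfst w).fderiv,
    (hG.hasFDerivAt_apply hy v w).fderiv]
  rfl

lemma apply_christoffelMap (hG : IsPseudoRiemannianOn G U) (hy : y ∈ U) (v w u : E) :
    G y (christoffelMap G y v w) u =
      2⁻¹ * (fderiv ℝ G y v w u + fderiv ℝ G y w v u - fderiv ℝ G y u v w) := by
  change G y ((G y).inverse _) u = _
  rw [hG.apply_inverse hy]
  rfl

lemma christoffelMap_eq (hG : IsPseudoRiemannianOn G U) (hy : y ∈ U) {v w x : E}
    (hx : ∀ u, G y x u =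
      2⁻¹ * (fderiv ℝ G y v w u + fderiv ℝ G y w v u - fderiv ℝ G y u v w)) :
    christoffelMap G y v w = x :=
  hG.eq_of_forall_apply_eq hy fun u ↦ by rw [hG.apply_christoffelMap hy, hx]

lemma christoffelMap_symm (hG : IsPseudoRiemannianOn G U) (hy : y ∈ U) (v w : E) :
    christoffelMap G y v w = christoffelMap G y w v :=
  hG.christoffelMap_eq hy fun u ↦ by
    rw [hG.apply_christoffelMap hy, hG.fderiv_symm hy u w v]
    ring

lemma fderiv_apply_eq (hG : IsPseudoRiemannianOn G U) (hy : y ∈ U) (u v w : E) :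
    fderiv ℝ G y u v w =
      G y (christoffelMap G y u v) w + G y v (christoffelMap G y u w) := by
  rw [hG.symm y hy v, hG.apply_christoffelMap hy, hG.apply_christoffelMap hy,
    hG.fderiv_symm hy u w v, hG.fderiv_symm hy v u w, hG.fderiv_symm hy w u v]
  ring

lemma apply_grad (hG : IsPseudoRiemannianOn G U) (hy : y ∈ U) :
    G y (grad G φ y) = fderiv ℝ φ y :=
  hG.apply_inverse hy _

variable [CompleteSpace E]

lemma contDiffAt_inverse (hG : IsPseudoRiemannianOn G U) (hy : y ∈ U) :
    ContDiffAt ℝ ∞ (fun z ↦ (G z).inverse) y := by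
  obtain ⟨e, he⟩ := hG.isInvertible y hy
  exact (he ▸ contDiffAt_map_inverse e).comp y (hG.contDiffAt hy)

lemma contDiffAt_christoffelMap (hG : IsPseudoRiemannianOn G U) (hy : y ∈ U) :
    ContDiffAt ℝ ∞ (christoffelMap G) y := by
  have hDG : ContDiffAt ℝ ∞ (fderiv ℝ G) y := (hG.contDiffAt hy).fderiv_right le_rfl
  have hflip : ContDiffAt ℝ ∞ (fun z ↦ (fderiv ℝ G z).flip) y :=
    (ContinuousLinearMap.flipₗᵢ ℝ E E (E →L[ℝ] ℝ)).contDiff.contDiffAt.comp y hDG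
  exact ((ContinuousLinearMap.compL ℝ E (E →L[ℝ] ℝ) E).contDiff.contDiffAt.comp y
    (hG.contDiffAt_inverse hy)).clm_comp
      (((hDG.add hflip).sub (contDiffAt_const.clm_comp hflip)).const_smul (2⁻¹ : ℝ))

lemma hasFDerivAt_christoffelMap (hG : IsPseudoRiemannianOn G U) (hy : y ∈ U) :
    HasFDerivAt (christoffelMap G) (fderiv ℝ (christoffelMap G) y) y :=
  ((hG.contDiffAt_christoffelMap hy).differentiableAt (by simp)).hasFDerivAt

lemma hasFDerivAt_christoffelMap_apply (hG : IsPseudoRiemannianOn G U) (hy : y ∈ U) (v w : E) :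
    HasFDerivAt (fun z ↦ christoffelMap G z v w)
      (((fderiv ℝ (christoffelMap G) y).flip v).flip w) y := by
  simpa using ((hG.hasFDerivAt_christoffelMap hy).clm_apply (hasFDerivAt_const v y)).clm_apply
    (hasFDerivAt_const w y)

lemma fderiv_christoffelMap_eq (hG : IsPseudoRiemannianOn G U) (hy : y ∈ U) {v w : E}
    {f : E → E} {f' : E →L[ℝ] E} (hf : ∀ z ∈ U, christoffelMap G z v w = f z)
    (hf' : HasFDerivAt f f' y) (u : E) : fderiv ℝ (christoffelMap G) y u v w = f' u := by
  have hev : (fun z ↦ christoffelMap G z v w) =ᶠ[𝓝 y] f := by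
    filter_upwards [hG.mem_nhds hy] with z hz using hf z hz
  exact congr($((hG.hasFDerivAt_christoffelMap_apply hy v w).unique
    (hf'.congr_of_eventuallyEq hev)) u)

lemma fderiv_christoffelMap_symm (hG : IsPseudoRiemannianOn G U) (hy : y ∈ U) (u v w : E) :
    fderiv ℝ (christoffelMap G) y u v w = fderiv ℝ (christoffelMap G) y u w v :=
  hG.fderiv_christoffelMap_eq hy (fun _ hz ↦ hG.christoffelMap_symm hz v w)
    (hG.hasFDerivAt_christoffelMap_apply hy w v) u

lemma riemann_eq_riemannMap (hG : IsPseudoRiemannianOn G U) (hy : y ∈ U) (u v w : E) :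
    riemann G y u v w = riemannMap G y u v w := by
  have hfderiv (a b : E) : fderiv ℝ (fun z ↦ christoffel G z a b) y =
      ((fderiv ℝ (christoffelMap G) y).flip a).flip b := by
    refine ((hG.hasFDerivAt_christoffelMap_apply hy a b).congr_of_eventuallyEq ?_).fderiv
    filter_upwards [hG.mem_nhds hy] with z hz using hG.christoffel_eq_christoffelMap hz a b
  simp only [riemann, hfderiv, hG.christoffel_eq_christoffelMap hy]
  rfl

lemma fderiv_fderiv_apply_self (hG : IsPseudoRiemannianOn G U) (hy : y ∈ U) (u v w : E) :
    fderiv ℝ (fderiv ℝ fun z ↦ G z w w) y u v =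
      2 * (G y (fderiv ℝ (christoffelMap G) y u v w) w +
        G y (christoffelMap G y u (christoffelMap G y v w)) w +
        G y (christoffelMap G y v w) (christoffelMap G y u w)) := by
  have hfderiv : (fun z ↦ fderiv ℝ (fun x ↦ G x w w) z v) =ᶠ[𝓝 y]
      fun z ↦ 2 * G z (christoffelMap G z v w) w := by
    filter_upwards [hG.mem_nhds hy] with z hz
    rw [(hG.hasFDerivAt_apply hz w w).fderiv]
    simp only [ContinuousLinearMap.flip_apply]
    rw [hG.fderiv_apply_eq hz, hG.symm z hz w, two_mul]
  have hsnd : DifferentiableAt ℝ (fderiv ℝ fun z ↦ G z w w) y :=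
    ((((hG.contDiffAt hy).clm_apply contDiffAt_const).clm_apply contDiffAt_const).fderiv_right
      (m := ∞) le_rfl).differentiableAt (by simp)
  have hleft := hsnd.hasFDerivAt.clm_apply (hasFDerivAt_const v y)
  have hright := (((hG.hasFDerivAt hy).clm_apply
    (hG.hasFDerivAt_christoffelMap_apply hy v w)).clm_apply (hasFDerivAt_const w y)).const_mul 2
  have := congr($(hleft.unique (hright.congr_of_eventuallyEq hfderiv)) u)
  simp only [ContinuousLinearMap.comp_zero, zero_add, ContinuousLinearMap.flip_apply, add_apply,
    smul_apply, ContinuousLinearMap.comp_apply, smul_eq_mul, hG.fderiv_apply_eq hy] at this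
  rw [this]
  ring

/- Both mixed second derivatives of `z ↦ G z w w` agree; their difference is
`2 * G (R(u, v) w) w`. -/
lemma apply_riemannMap_self (hG : IsPseudoRiemannianOn G U) (hy : y ∈ U) (u v w : E) :
    G y (riemannMap G y u v w) w = 0 := by
  have hcontDiff : ContDiffAt ℝ ∞ (fun z ↦ G z w w) y :=
    ((hG.contDiffAt hy).clm_apply contDiffAt_const).clm_apply contDiffAt_const
  have hsymm := hcontDiff.isSymmSndFDerivAt (by simpa using ENat.LEInfty.out) u v
  rw [hG.fderiv_fderiv_apply_self hy, hG.fderiv_fderiv_apply_self hy,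
    hG.symm y hy (christoffelMap G y u w)] at hsymm
  simp only [riemannMap_apply, add_apply, sub_apply, map_add, map_sub]
  linarith

lemma contDiffAt_grad (hG : IsPseudoRiemannianOn G U) (hy : y ∈ U) (hφ : ContDiffAt ℝ ∞ φ y) :
    ContDiffAt ℝ ∞ (grad G φ) y :=
  (hG.contDiffAt_inverse hy).clm_apply (hφ.fderiv_right le_rfl)

lemma hasFDerivAt_grad (hG : IsPseudoRiemannianOn G U) (hy : y ∈ U) (hφ : ContDiffAt ℝ ∞ φ y) :
    HasFDerivAt (grad G φ) (fderiv ℝ (grad G φ) y) y :=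
  ((hG.contDiffAt_grad hy hφ).differentiableAt (by simp)).hasFDerivAt

lemma apply_covDerivGrad (hG : IsPseudoRiemannianOn G U) (hy : y ∈ U)
    (hφ : ContDiffAt ℝ ∞ φ y) (v w : E) :
    G y (covDerivGrad G φ y v) w = hessian G φ y v w := by
  have hfderiv : HasFDerivAt (fderiv ℝ φ) (fderiv ℝ (fderiv ℝ φ) y) y :=
    ((hφ.fderiv_right (m := ∞) le_rfl).differentiableAt (by simp)).hasFDerivAt
  have hgrad : (fun z ↦ G z (grad G φ z)) =ᶠ[𝓝 y] fderiv ℝ φ := by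
    filter_upwards [hG.mem_nhds hy] with z hz using hG.apply_grad hz
  have := congr($(((hG.hasFDerivAt hy).clm_apply (hG.hasFDerivAt_grad hy hφ)).unique
    (hfderiv.congr_of_eventuallyEq hgrad)) v w)
  simp only [ContinuousLinearMap.flip_apply, add_apply, ContinuousLinearMap.comp_apply,
    hG.fderiv_apply_eq hy, hG.apply_grad hy] at this
  simp only [covDerivGrad, hessian, ← this, add_apply, map_add, ContinuousLinearMap.flip_apply]
  ring

lemma hasFDerivAt_apply_grad_self (hG : IsPseudoRiemannianOn G U) (hy : y ∈ U)
    (hφ : ContDiffAt ℝ ∞ φ y) :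
    HasFDerivAt (fun z ↦ G z (grad G φ z) (grad G φ z))
      ((2 : ℝ) • (G y (grad G φ y)).comp (covDerivGrad G φ y)) y := by
  refine (((hG.hasFDerivAt hy).clm_apply (hG.hasFDerivAt_grad hy hφ)).clm_apply
    (hG.hasFDerivAt_grad hy hφ)).congr_fderiv ?_
  ext u
  simp only [ContinuousLinearMap.flip_apply, add_apply, smul_apply, smul_eq_mul,
    ContinuousLinearMap.comp_apply, hG.fderiv_apply_eq hy, covDerivGrad, map_add,
    hG.symm y hy _ (grad G φ y)]
  ring

end IsPseudoRiemannianOn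

lemma christoffel_congr {G' : E → E →L[ℝ] E →L[ℝ] ℝ} (h : G =ᶠ[𝓝 y] G') :
    christoffel G y = christoffel G' y := by
  have hfst (a : E) : (fun z ↦ G z a) =ᶠ[𝓝 y] fun z ↦ G' z a := h.fun_comp (· a)
  have hsnd (a b : E) : (fun z ↦ G z a b) =ᶠ[𝓝 y] fun z ↦ G' z a b := h.fun_comp (· a b)
  ext v w
  rw [christoffel, christoffel, christoffelFirst, christoffelFirst, h.self_of_nhds,
    (hfst w).fderiv_eq, (hfst v).fderiv_eq, (hsnd v w).fderiv_eq]

lemma riemann_congr {G' : E → E →L[ℝ] E →L[ℝ] ℝ} (h : G =ᶠ[𝓝 y] G') :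
    riemann G y = riemann G' y := by
  have hchristoffel (a b : E) :
      (fun z ↦ christoffel G z a b) =ᶠ[𝓝 y] fun z ↦ christoffel G' z a b := by
    filter_upwards [h.eventuallyEq_nhds] with z hz
    rw [christoffel_congr hz]
  ext u v w
  simp only [riemann, christoffel_congr h, (hchristoffel _ _).fderiv_eq]

variable [FiniteDimensional ℝ E]

lemma ricci_congr {G' : E → E →L[ℝ] E →L[ℝ] ℝ} (h : G =ᶠ[𝓝 y] G') :
    ricci G y = ricci G' y := by
  ext v w
  simp only [ricci, riemann_congr h]

lemma isInvertible_of_pos {β : E →L[ℝ] E →L[ℝ] ℝ} (hβ : ∀ v ≠ 0, 0 < β v v) :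
    β.IsInvertible := by
  have hinj : Function.Injective (β : E →ₗ[ℝ] E →L[ℝ] ℝ) := by
    refine (injective_iff_map_eq_zero _).2 fun v hv ↦ by_contra fun hv0 ↦ (hβ v hv0).ne' ?_
    exact congr($hv v)
  have hrank : Module.finrank ℝ E = Module.finrank ℝ (E →L[ℝ] ℝ) := by
    rw [← LinearMap.toContinuousLinearMap.finrank_eq]
    exact Subspace.dual_finrank_eq.symm
  exact ⟨(LinearEquiv.ofInjectiveOfFinrankEq _ hinj hrank).toContinuousLinearEquiv, rfl⟩

/-- The Ricci curvature as a continuous bilinear map. -/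
def ricciForm (G : E → E →L[ℝ] E →L[ℝ] ℝ) (y : E) : E →L[ℝ] E →L[ℝ] ℝ :=
  ∑ i, ContinuousLinearMap.compL ℝ E E ℝ ((Module.finBasis ℝ E).coord i).toContinuousLinearMap ∘L
    riemannMap G y (Module.finBasis ℝ E i)

namespace IsPseudoRiemannianOn

lemma ricci_eq_ricciForm (hG : IsPseudoRiemannianOn G U) (hy : y ∈ U) (v w : E) :
    ricci G y v w = ricciForm G y v w := by
  simp only [ricci, hG.riemann_eq_riemannMap hy, ricciForm, sum_apply]
  rfl

lemma ricci_eq_trace (hG : IsPseudoRiemannianOn G U) (hy : y ∈ U) (v w : E) :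
    ricci G y v w = LinearMap.trace ℝ E (((riemannMap G y).flip v).flip w) := by
  rw [LinearMap.trace_eq_matrix_trace ℝ (Module.finBasis ℝ E), Matrix.trace]
  simp [ricci, hG.riemann_eq_riemannMap hy, LinearMap.toMatrix_apply]

lemma scalar_eq_trace (hG : IsPseudoRiemannianOn G U) (hy : y ∈ U) (S : E →ₗ[ℝ] E)
    (hS : ∀ v w, ricci G y v w = G y v (S w)) : scalar G y = LinearMap.trace ℝ E S := by
  set b := Module.finBasis ℝ E
  rw [LinearMap.trace_eq_matrix_trace ℝ b, Matrix.trace, scalar, Finset.sum_comm]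
  refine Finset.sum_congr rfl fun j _ ↦ ?_
  set X := (G y).inverse (b.coord j).toContinuousLinearMap with hX
  calc ∑ i, b.coord i X * ricci G y (b i) (b j)
      = G y (∑ i, b.coord i X • b i) (S (b j)) := by
        simp only [hS, map_sum, map_smul, sum_apply, smul_apply, smul_eq_mul]
    _ = G y X (S (b j)) := by
        rw [show ∑ i, b.coord i X • b i = X from b.sum_repr X]
    _ = b.coord j (S (b j)) := by
        rw [hX, hG.apply_inverse hy, LinearMap.coe_toContinuousLinearMap']
    _ = _ := by simp only [Matrix.diag_apply, LinearMap.toMatrix_apply, b.coord_apply]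

end IsPseudoRiemannianOn

end LeviCivita

section Surface

lemma eq_smulRight_trace_sub_flip {R V : Type*} [CommRing R] [Nontrivial R] [AddCommGroup V]
    [Module R V] [Module.Free R V] [Module.Finite R V] (hV : Module.finrank R V = 2)
    (A : V →ₗ[R] V →ₗ[R] V) (hA : A.IsAlt) :
    A = (LinearMap.trace R V ∘ₗ A).smulRight LinearMap.id -
      ((LinearMap.trace R V ∘ₗ A).smulRight LinearMap.id).flip := by
  let b := Module.finBasisOfFinrankEq R V hV
  have htrace (x : V) : LinearMap.trace R V (A x) =
      b.repr (A x (b 0)) 0 + b.repr (A x (b 1)) 1 := by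
    rw [LinearMap.trace_eq_matrix_trace R b, Matrix.trace, Fin.sum_univ_two]
    simp only [Matrix.diag_apply, LinearMap.toMatrix_apply]
  have hsum (x : V) : b.repr x 0 • b 0 + b.repr x 1 • b 1 = x := by
    rw [← Fin.sum_univ_two fun i ↦ b.repr x i • b i, b.sum_repr]
  have h01 : A (b 0) (b 1) =
      LinearMap.trace R V (A (b 0)) • b 1 - LinearMap.trace R V (A (b 1)) • b 0 := by
    rw [htrace, htrace, hA.self_eq_zero, hA.self_eq_zero, ← hA.neg (b 0) (b 1)]
    conv_lhs => rw [← hsum (A (b 0) (b 1))]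
    simp only [map_zero, map_neg, Finsupp.coe_zero, Finsupp.coe_neg, Pi.zero_apply, Pi.neg_apply]
    module
  refine b.ext fun i ↦ b.ext fun j ↦ ?_
  simp only [LinearMap.sub_apply, LinearMap.smulRight_apply, LinearMap.flip_apply,
    LinearMap.smul_apply, LinearMap.comp_apply, LinearMap.id_apply]
  fin_cases i <;> fin_cases j
  · simpa using hA.self_eq_zero (b 0)
  · exact h01
  · rw [← neg_sub]
    exact (hA.neg _ _).symm.trans (congrArg _ h01)
  · simpa using hA.self_eq_zero (b 1)

variable {E : Type*} [NormedAddCommGroup E] [NormedSpace ℝ E] [FiniteDimensional ℝ E]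
  {G : E → E →L[ℝ] E →L[ℝ] ℝ} {U : Set E} {y : E}

namespace IsPseudoRiemannianOn

lemma riemannMap_eq_ricci (hG : IsPseudoRiemannianOn G U) (hy : y ∈ U)
    (hE : Module.finrank ℝ E = 2) (u v w : E) :
    riemannMap G y u v w = ricci G y v w • u - ricci G y u w • v := by
  let A : E →ₗ[ℝ] E →ₗ[ℝ] E := LinearMap.mk₂ ℝ (fun v u ↦ riemannMap G y u v w)
    (by simp) (by simp) (by simp) (by simp)
  have hA : A.IsAlt := fun u ↦ riemannMap_self G y u w
  rw [hG.ricci_eq_trace hy, hG.ricci_eq_trace hy]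
  exact congr($(eq_smulRight_trace_sub_flip hE A hA) v u)

lemma riemann_eq_zero_of_ricci_eq_zero (hG : IsPseudoRiemannianOn G U) (hy : y ∈ U)
    (hE : Module.finrank ℝ E = 2) (hricci : ∀ v w, ricci G y v w = 0) (u v w : E) :
    riemann G y u v w = 0 := by
  rw [hG.riemann_eq_riemannMap hy, hG.riemannMap_eq_ricci hy hE]
  simp only [hricci, zero_smul, sub_zero]

/- With `S` the Ricci endomorphism, skew-adjointness of the curvature reads
`G (S w) v * G u w = G (S w) u * G v w`, so every vector is an eigenvector of `S`. -/
lemma two_mul_ricci_eq (hG : IsPseudoRiemannianOn G U) (hy : y ∈ U)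
    (hE : Module.finrank ℝ E = 2) (v w : E) :
    2 * ricci G y v w = scalar G y * G y v w := by
  let S : E →ₗ[ℝ] E := ((G y).inverse ∘L (ricciForm G y).flip : E →L[ℝ] E)
  have hS (v w : E) : ricci G y v w = G y v (S w) := by
    rw [hG.ricci_eq_ricciForm hy, hG.symm y hy v]
    exact congr($(hG.apply_inverse hy ((ricciForm G y).flip w)) v).symm
  have heigen (w : E) : ¬LinearIndependent ℝ ![w, S w] := by
    intro hw
    have hskew (u v : E) : G y v (S w) * G y u w = G y u (S w) * G y v w := by
      have := hG.apply_riemannMap_self hy u v w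
      rw [hG.riemannMap_eq_ricci hy hE, hS, hS] at this
      simp only [map_sub, map_smul, sub_apply, smul_apply, smul_eq_mul] at this
      linarith
    have hcomb (u : E) : G y u w • S w = G y u (S w) • w :=
      hG.eq_of_forall_apply_eq hy fun v ↦ by
        simp only [map_smul, smul_apply, smul_eq_mul, hG.symm y hy _ v]
        linarith [hskew u v]
    have hzero (u : E) : G y w u = 0 := by
      rw [hG.symm y hy]
      have := LinearIndependent.pair_iff.1 hw (-G y u (S w)) (G y u w) (by rw [hcomb]; module)
      exact this.2
    exact hw.ne_zero 0 (hG.eq_of_forall_apply_eq hy fun u ↦ by simpa using hzero u)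
  obtain ⟨μ, hμ⟩ := LinearMap.exists_eq_smul_id_of_forall_notLinearIndependent heigen
  rw [hG.scalar_eq_trace hy S hS, hS, hμ, map_smul, LinearMap.trace_one, hE]
  simp only [LinearMap.smul_apply, Module.End.one_apply, map_smul, smul_eq_mul]
  push_cast
  ring

end IsPseudoRiemannianOn

end Surface

section WarpedProduct

variable {E : Type*} [NormedAddCommGroup E] [NormedSpace ℝ E]
  {E' : Type*} [NormedAddCommGroup E'] [NormedSpace ℝ E']

lemma contDiffOn_pullbackForm {X : Type*} [NormedAddCommGroup X] [NormedSpace ℝ X] {s : Set X}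
    {A : X → E →L[ℝ] E'} {β : X → E' →L[ℝ] E' →L[ℝ] ℝ} (hA : ContDiffOn ℝ ∞ A s)
    (hβ : ContDiffOn ℝ ∞ β s) : ContDiffOn ℝ ∞ (fun x ↦ pullbackForm (A x) (β x)) s :=
  (ContinuousLinearMap.flipₗᵢ ℝ E E ℝ).contDiff.comp_contDiffOn
    (((ContinuousLinearMap.flipₗᵢ ℝ E E' ℝ).contDiff.comp_contDiffOn (hβ.clm_comp hA)).clm_comp hA)

/-- The coordinate expression `G + φ² K` of a warped product metric on `E × E'`. -/
def warpedForm (G : E → E →L[ℝ] E →L[ℝ] ℝ) (φ : E → ℝ) (K : E' → E' →L[ℝ] E' →L[ℝ] ℝ)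
    (z : E × E') : E × E' →L[ℝ] E × E' →L[ℝ] ℝ :=
  pullbackForm (ContinuousLinearMap.fst ℝ E E') (G z.1) +
    φ z.1 ^ 2 • pullbackForm (ContinuousLinearMap.snd ℝ E E') (K z.2)

lemma warpedForm_apply (G : E → E →L[ℝ] E →L[ℝ] ℝ) (φ : E → ℝ)
    (K : E' → E' →L[ℝ] E' →L[ℝ] ℝ) (z a b : E × E') :
    warpedForm G φ K z a b = G z.1 a.1 b.1 + φ z.1 ^ 2 * K z.2 a.2 b.2 := rfl

/-- The data of a warped product metric `G + φ² K` over `U ×ˢ V`: the base and fiber metrics are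
pseudo-Riemannian and the warping function is smooth and nowhere zero. -/
structure IsWarpedProductOn (G : E → E →L[ℝ] E →L[ℝ] ℝ) (φ : E → ℝ)
    (K : E' → E' →L[ℝ] E' →L[ℝ] ℝ) (U : Set E) (V : Set E') : Prop where
  base : IsPseudoRiemannianOn G U
  fiber : IsPseudoRiemannianOn K V
  contDiffOn : ContDiffOn ℝ ∞ φ U
  ne_zero : ∀ y ∈ U, φ y ≠ 0

variable {G : E → E →L[ℝ] E →L[ℝ] ℝ} {φ : E → ℝ} {K : E' → E' →L[ℝ] E' →L[ℝ] ℝ}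
  {U : Set E} {V : Set E'} {y : E} {z : E × E'}

lemma isInvertible_add_smul_pullbackForm {β : E →L[ℝ] E →L[ℝ] ℝ} {γ : E' →L[ℝ] E' →L[ℝ] ℝ}
    (hβ : β.IsInvertible) (hγ : γ.IsInvertible) {r : ℝ} (hr : r ≠ 0) :
    (pullbackForm (ContinuousLinearMap.fst ℝ E E') β +
      r • pullbackForm (ContinuousLinearMap.snd ℝ E E') γ).IsInvertible := by
  set form := pullbackForm (ContinuousLinearMap.fst ℝ E E') β +
    r • pullbackForm (ContinuousLinearMap.snd ℝ E E') γ
  let restrictFst := (ContinuousLinearMap.compL ℝ E (E × E') ℝ).flip (.inl ℝ E E')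
  let restrictSnd := (ContinuousLinearMap.compL ℝ E' (E × E') ℝ).flip (.inr ℝ E E')
  have happly (v w : E × E') : form v w = β v.1 w.1 + r * γ v.2 w.2 := rfl
  refine .of_inverse (g := (β.inverse ∘L restrictFst).prod (r⁻¹ • γ.inverse ∘L restrictSnd)) ?_ ?_
  · ext l v
    · simp [happly, restrictFst, hβ.self_apply_inverse]
    · simp [happly, restrictSnd, hγ.self_apply_inverse, hr]
  · refine ContinuousLinearMap.ext fun v ↦ ?_
    have hfst : restrictFst (form v) = β v.1 := by ext; simp [restrictFst, happly]
    have hsnd : restrictSnd (form v) = r • γ v.2 := by ext; simp [restrictSnd, happly]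
    simp [hfst, hsnd, hβ.inverse_apply_self, hγ.inverse_apply_self, hr]

namespace IsWarpedProductOn

lemma contDiffAt (h : IsWarpedProductOn G φ K U V) (hy : y ∈ U) : ContDiffAt ℝ ∞ φ y :=
  h.contDiffOn.contDiffAt (h.base.mem_nhds hy)

lemma hasFDerivAt (h : IsWarpedProductOn G φ K U V) (hy : y ∈ U) :
    HasFDerivAt φ (fderiv ℝ φ y) y :=
  ((h.contDiffAt hy).differentiableAt (by simp)).hasFDerivAt

lemma isPseudoRiemannianOn (h : IsWarpedProductOn G φ K U V) :
    IsPseudoRiemannianOn (warpedForm G φ K) (U ×ˢ V) where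
  isOpen := h.base.isOpen.prod h.fiber.isOpen
  contDiffOn := by
    have hfst : Set.MapsTo Prod.fst (U ×ˢ V) U := fun _ hz ↦ hz.1
    have hsnd : Set.MapsTo Prod.snd (U ×ˢ V) V := fun _ hz ↦ hz.2
    exact (contDiffOn_pullbackForm contDiffOn_const
      (h.base.contDiffOn.comp contDiff_fst.contDiffOn hfst)).add
        (((h.contDiffOn.comp contDiff_fst.contDiffOn hfst).pow 2).smul
          (contDiffOn_pullbackForm contDiffOn_const
            (h.fiber.contDiffOn.comp contDiff_snd.contDiffOn hsnd)))
  symm z hz v w := by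
    rw [warpedForm_apply, warpedForm_apply, h.base.symm z.1 hz.1 v.1, h.fiber.symm z.2 hz.2 v.2]
  isInvertible z hz := isInvertible_add_smul_pullbackForm (h.base.isInvertible z.1 hz.1)
    (h.fiber.isInvertible z.2 hz.2) (pow_ne_zero 2 (h.ne_zero z.1 hz.1))

lemma fderiv_warpedForm (h : IsWarpedProductOn G φ K U V) (hz : z ∈ U ×ˢ V) (d a b : E × E') :
    fderiv ℝ (warpedForm G φ K) z d a b =
      fderiv ℝ G z.1 d.1 a.1 b.1 + 2 * φ z.1 * fderiv ℝ φ z.1 d.1 * K z.2 a.2 b.2 +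
        φ z.1 ^ 2 * fderiv ℝ K z.2 d.2 a.2 b.2 := by
  have hG := (h.base.hasFDerivAt_apply hz.1 a.1 b.1).comp z hasFDerivAt_fst
  have hK := (h.fiber.hasFDerivAt_apply hz.2 a.2 b.2).comp z hasFDerivAt_snd
  have hφK := (((h.hasFDerivAt hz.1).comp z hasFDerivAt_fst).pow 2).mul hK
  have := congr($((h.isPseudoRiemannianOn.hasFDerivAt_apply hz a b).unique (hG.add hφK)) d)
  simp only [ContinuousLinearMap.flip_apply, add_apply, smul_apply, smul_eq_mul,
    ContinuousLinearMap.comp_apply, ContinuousLinearMap.coe_fst', ContinuousLinearMap.coe_snd',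
    Function.comp_apply] at this
  rw [this]
  simp only [nsmul_eq_mul, Nat.cast_ofNat]
  ring

lemma christoffelMap_warpedForm (h : IsWarpedProductOn G φ K U V) (hz : z ∈ U ×ˢ V)
    (v w : E × E') :
    christoffelMap (warpedForm G φ K) z v w =
      (christoffelMap G z.1 v.1 w.1 - (φ z.1 * K z.2 v.2 w.2) • grad G φ z.1,
        christoffelMap K z.2 v.2 w.2 + (fderiv ℝ φ z.1 v.1 / φ z.1) • w.2 +
          (fderiv ℝ φ z.1 w.1 / φ z.1) • v.2) := by
  refine h.isPseudoRiemannianOn.christoffelMap_eq hz fun u ↦ ?_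
  have hne : φ z.1 ≠ 0 := h.ne_zero _ hz.1
  simp only [h.fderiv_warpedForm hz, warpedForm_apply, map_sub, map_add, map_smul, sub_apply,
    add_apply, smul_apply, smul_eq_mul, h.base.apply_christoffelMap hz.1,
    h.fiber.apply_christoffelMap hz.2, h.base.apply_grad hz.1]
  field_simp
  ring

variable [CompleteSpace E] [CompleteSpace E']

lemma fderiv_christoffelMap_horizontal (h : IsWarpedProductOn G φ K U V) (hz : z ∈ U ×ˢ V)
    (v w : E) (d : E × E') :
    fderiv ℝ (christoffelMap (warpedForm G φ K)) z d (v, 0) (w, 0) =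
      (fderiv ℝ (christoffelMap G) z.1 d.1 v w, 0) := by
  have hΓ := (h.base.hasFDerivAt_christoffelMap_apply hz.1 v w).comp z hasFDerivAt_fst
  refine h.isPseudoRiemannianOn.fderiv_christoffelMap_eq hz (fun x hx ↦ ?_)
    (hΓ.prodMk (hasFDerivAt_const 0 z)) d
  simp [h.christoffelMap_warpedForm hx]

lemma fderiv_christoffelMap_mixed (h : IsWarpedProductOn G φ K U V) (hz : z ∈ U ×ˢ V)
    (v : E) (b : E') (d : E × E') :
    fderiv ℝ (christoffelMap (warpedForm G φ K)) z d (v, 0) (0, b) =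
      (0, (fderiv ℝ (fderiv ℝ φ) z.1 d.1 v / φ z.1 -
        fderiv ℝ φ z.1 d.1 * fderiv ℝ φ z.1 v / φ z.1 ^ 2) • b) := by
  have hne : φ z.1 ≠ 0 := h.ne_zero _ hz.1
  have hdφ : HasFDerivAt (fun y ↦ fderiv ℝ φ y v) ((fderiv ℝ (fderiv ℝ φ) z.1).flip v) z.1 := by
    simpa using ((((h.contDiffAt hz.1).fderiv_right (m := ∞) le_rfl).differentiableAt
      (by simp)).hasFDerivAt).clm_apply (hasFDerivAt_const v z.1)
  have hquot := ((hdφ.mul ((hasDerivAt_inv hne).comp_hasFDerivAt z.1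
    (h.hasFDerivAt hz.1))).comp z hasFDerivAt_fst).smul_const b
  refine (h.isPseudoRiemannianOn.fderiv_christoffelMap_eq hz (fun x hx ↦ ?_)
    ((hasFDerivAt_const 0 z).prodMk hquot) d).trans ?_
  · simp [h.christoffelMap_warpedForm hx, div_eq_mul_inv]
  · simp only [neg_smul, smul_neg, Function.comp_apply, ContinuousLinearMap.add_comp,
      ContinuousLinearMap.neg_comp, ContinuousLinearMap.smul_comp,
      ContinuousLinearMap.prod_apply, zero_apply, ContinuousLinearMap.smulRight_apply, add_apply,
      neg_apply, smul_apply, ContinuousLinearMap.comp_apply, ContinuousLinearMap.coe_fst',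
      smul_eq_mul, ContinuousLinearMap.flip_apply, Prod.mk.injEq, true_and]
    congr 1
    field_simp
    ring

lemma fderiv_christoffelMap_vertical (h : IsWarpedProductOn G φ K U V) (hz : z ∈ U ×ˢ V)
    (a b : E') (d : E × E') :
    fderiv ℝ (christoffelMap (warpedForm G φ K)) z d (0, a) (0, b) =
      (-((fderiv ℝ φ z.1 d.1 * K z.2 a b + φ z.1 * fderiv ℝ K z.2 d.2 a b) • grad G φ z.1) -
        (φ z.1 * K z.2 a b) • fderiv ℝ (grad G φ) z.1 d.1,
        fderiv ℝ (christoffelMap K) z.2 d.2 a b) := by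
  have hφ := (h.hasFDerivAt hz.1).comp z hasFDerivAt_fst
  have hK := (h.fiber.hasFDerivAt_apply hz.2 a b).comp z hasFDerivAt_snd
  have hgrad := (h.base.hasFDerivAt_grad hz.1 (h.contDiffAt hz.1)).comp z hasFDerivAt_fst
  have hΓ := (h.fiber.hasFDerivAt_christoffelMap_apply hz.2 a b).comp z hasFDerivAt_snd
  refine (h.isPseudoRiemannianOn.fderiv_christoffelMap_eq hz (fun x hx ↦ ?_)
    (((hφ.mul hK).smul hgrad).neg.prodMk hΓ) d).trans ?_
  · simp [h.christoffelMap_warpedForm hx]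
  · ext1
    · simp only [Pi.mul_apply, Function.comp_apply, neg_add_rev, ContinuousLinearMap.prod_apply,
        add_apply, neg_apply, ContinuousLinearMap.smulRight_apply, smul_apply,
        ContinuousLinearMap.comp_apply, ContinuousLinearMap.coe_snd',
        ContinuousLinearMap.flip_apply, smul_eq_mul, ContinuousLinearMap.coe_fst']
      module
    · simp

lemma riemannMap_horizontal_horizontal_fst (h : IsWarpedProductOn G φ K U V)
    (hz : z ∈ U ×ˢ V) (u v w : E) :
    (riemannMap (warpedForm G φ K) z (u, 0) (v, 0) (w, 0)).1 = riemannMap G z.1 u v w := by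
  simp [riemannMap_apply, h.fderiv_christoffelMap_horizontal hz, h.christoffelMap_warpedForm hz]

lemma riemannMap_vertical_horizontal_snd (h : IsWarpedProductOn G φ K U V)
    (hz : z ∈ U ×ˢ V) (p : E') (v w : E) :
    (riemannMap (warpedForm G φ K) z (0, p) (v, 0) (w, 0)).2 =
      -(hessian G φ z.1 v w / φ z.1) • p := by
  have hne : φ z.1 ≠ 0 := h.ne_zero _ hz.1
  simp only [riemannMap_apply, h.fderiv_christoffelMap_horizontal hz, map_zero, zero_apply,
    h.isPseudoRiemannianOn.fderiv_christoffelMap_symm hz _ (0, p), h.fderiv_christoffelMap_mixed hz,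
    Prod.mk_sub_mk, sub_self, zero_sub, h.christoffelMap_warpedForm hz, mul_zero, zero_smul,
    sub_zero, smul_zero, add_zero, zero_div, zero_add, Prod.mk_add_mk, map_smul, smul_eq_mul,
    hessian, neg_smul]
  match_scalars
  field_simp
  ring

lemma riemannMap_horizontal_vertical_fst (h : IsWarpedProductOn G φ K U V)
    (hz : z ∈ U ×ˢ V) (u : E) (a b : E') :
    (riemannMap (warpedForm G φ K) z (u, 0) (0, a) (0, b)).1 =
      -(φ z.1 * K z.2 a b) • covDerivGrad G φ z.1 u := by
  have hne : φ z.1 ≠ 0 := h.ne_zero _ hz.1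
  simp only [riemannMap_apply, h.fderiv_christoffelMap_vertical hz, map_zero, zero_apply, mul_zero,
    add_zero, h.fderiv_christoffelMap_mixed hz, zero_div, zero_mul, sub_self, zero_smul,
    Prod.mk_sub_mk, sub_zero, h.christoffelMap_warpedForm hz, zero_sub, map_neg, map_smul, zero_add,
    smul_eq_mul, smul_zero, Prod.mk_add_mk, sub_neg_eq_add, covDerivGrad, add_apply,
    ContinuousLinearMap.flip_apply, smul_add, neg_smul]
  match_scalars <;> field_simp
  ring

lemma riemannMap_vertical_vertical_snd (h : IsWarpedProductOn G φ K U V)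
    (hz : z ∈ U ×ˢ V) (p a b : E') :
    (riemannMap (warpedForm G φ K) z (0, p) (0, a) (0, b)).2 =
      riemannMap K z.2 p a b +
        G z.1 (grad G φ z.1) (grad G φ z.1) • (K z.2 p b • a - K z.2 a b • p) := by
  have hne : φ z.1 ≠ 0 := h.ne_zero _ hz.1
  simp only [riemannMap_apply, h.fderiv_christoffelMap_vertical hz, map_zero, zero_mul, zero_add,
    smul_zero, sub_zero, Prod.mk_sub_mk, sub_neg_eq_add, h.christoffelMap_warpedForm hz, zero_apply,
    zero_sub, zero_div, zero_smul, add_zero, map_neg, map_smul, smul_eq_mul, Prod.mk_add_mk,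
    h.base.apply_grad hz.1]
  match_scalars <;> field_simp

end IsWarpedProductOn

lemma trace_prod_eq_add {R M N : Type*} [CommRing R] [AddCommGroup M] [Module R M]
    [Module.Free R M] [Module.Finite R M] [AddCommGroup N] [Module R N] [Module.Free R N]
    [Module.Finite R N] (L : M × N →ₗ[R] M × N) :
    LinearMap.trace R (M × N) L =
      LinearMap.trace R M (LinearMap.fst R M N ∘ₗ L ∘ₗ LinearMap.inl R M N) +
        LinearMap.trace R N (LinearMap.snd R M N ∘ₗ L ∘ₗ LinearMap.inr R M N) := by
  have hL : L = (L ∘ₗ LinearMap.inl R M N) ∘ₗ LinearMap.fst R M N +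
      (L ∘ₗ LinearMap.inr R M N) ∘ₗ LinearMap.snd R M N := by
    exact LinearMap.ext fun ⟨m, n⟩ ↦ by simp [← map_add]
  conv_lhs => rw [hL, map_add]
  exact congrArg₂ _ (LinearMap.trace_comp_comm' _ _) (LinearMap.trace_comp_comm' _ _)

namespace IsWarpedProductOn

variable [FiniteDimensional ℝ E] [FiniteDimensional ℝ E']

lemma ricci_horizontal (h : IsWarpedProductOn G φ K U V) (hz : z ∈ U ×ˢ V) (v w : E) :
    ricci (warpedForm G φ K) z (v, 0) (w, 0) =
      ricci G z.1 v w - Module.finrank ℝ E' * (hessian G φ z.1 v w / φ z.1) := by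
  rw [h.isPseudoRiemannianOn.ricci_eq_trace hz, trace_prod_eq_add, h.base.ricci_eq_trace hz.1,
    sub_eq_add_neg]
  congr 1
  · exact congrArg _ (LinearMap.ext fun u ↦ h.riemannMap_horizontal_horizontal_fst hz u v w)
  · rw [mul_comm, ← neg_mul, ← LinearMap.trace_id, ← smul_eq_mul, ← map_smul]
    exact congrArg _ (LinearMap.ext fun p ↦ h.riemannMap_vertical_horizontal_snd hz p v w)

lemma ricci_vertical (h : IsWarpedProductOn G φ K U V) (hz : z ∈ U ×ˢ V) (a b : E') :
    ricci (warpedForm G φ K) z (0, a) (0, b) =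
      ricci K z.2 a b - (φ z.1 * laplacian G φ z.1 +
        (Module.finrank ℝ E' - 1) * G z.1 (grad G φ z.1) (grad G φ z.1)) * K z.2 a b := by
  set L := (((riemannMap (warpedForm G φ K) z).flip (0, a)).flip (0, b) : E × E' →ₗ[ℝ] E × E')
  have hfst : LinearMap.fst ℝ E E' ∘ₗ L ∘ₗ LinearMap.inl ℝ E E' =
      -(φ z.1 * K z.2 a b) • (covDerivGrad G φ z.1 : E →ₗ[ℝ] E) :=
    LinearMap.ext fun u ↦ h.riemannMap_horizontal_vertical_fst hz u a b
  have hsnd : LinearMap.snd ℝ E E' ∘ₗ L ∘ₗ LinearMap.inr ℝ E E' =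
      (((riemannMap K z.2).flip a).flip b : E' →ₗ[ℝ] E') + G z.1 (grad G φ z.1) (grad G φ z.1) •
        ((K z.2 b : E' →ₗ[ℝ] ℝ).smulRight a - K z.2 a b • LinearMap.id) :=
    LinearMap.ext fun p ↦ (h.riemannMap_vertical_vertical_snd hz p a b).trans
      (by rw [h.fiber.symm z.2 hz.2 p b]; rfl)
  rw [h.isPseudoRiemannianOn.ricci_eq_trace hz, trace_prod_eq_add, hfst, hsnd, map_add, map_smul,
    map_smul, map_sub, map_smul, LinearMap.trace_id, ← h.fiber.ricci_eq_trace hz.2,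
    LinearMap.trace_smulRight, ContinuousLinearMap.coe_coe, h.fiber.symm z.2 hz.2 b a, laplacian]
  simp only [smul_eq_mul]
  ring

end IsWarpedProductOn

end WarpedProduct

section ProportionalScalarCurvature

variable {E : Type*} [NormedAddCommGroup E] [NormedSpace ℝ E] [FiniteDimensional ℝ E]
  {E' : Type*} [NormedAddCommGroup E'] [NormedSpace ℝ E'] [FiniteDimensional ℝ E']
  {G : E → E →L[ℝ] E →L[ℝ] ℝ} {φ : E → ℝ} {K : E' → E' →L[ℝ] E' →L[ℝ] ℝ}
  {U : Set E} {V : Set E'} {y : E} {x a : E'} {z : E × E'} {c : ℝ}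

namespace IsWarpedProductOn

lemma ricci_fiber_eq (h : IsWarpedProductOn G φ K U V) (hz : z ∈ U ×ˢ V)
    (hflat : ∀ v w, ricci (warpedForm G φ K) z v w = 0) (a b : E') :
    ricci K z.2 a b = (φ z.1 * laplacian G φ z.1 +
      (Module.finrank ℝ E' - 1) * G z.1 (grad G φ z.1) (grad G φ z.1)) * K z.2 a b :=
  sub_eq_zero.1 ((h.ricci_vertical hz a b).symm.trans (hflat (0, a) (0, b)))

section Nontrivial

variable [Nontrivial E']

lemma covDerivGrad_eq_smul_id (h : IsWarpedProductOn G φ K U V) (hz : z ∈ U ×ˢ V)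
    (hflat : ∀ v w, ricci (warpedForm G φ K) z v w = 0) (hE : Module.finrank ℝ E = 2) :
    covDerivGrad G φ z.1 = (φ z.1 * scalar G z.1 / (2 * Module.finrank ℝ E')) •
      ContinuousLinearMap.id ℝ E := by
  have hm : (Module.finrank ℝ E' : ℝ) ≠ 0 := mod_cast Module.finrank_pos.ne'
  refine ContinuousLinearMap.ext fun v ↦ h.base.eq_of_forall_apply_eq hz.1 fun w ↦ ?_
  have hhorizontal := hflat (v, 0) (w, 0)
  rw [h.ricci_horizontal hz, sub_eq_zero, ← h.base.apply_covDerivGrad hz.1 (h.contDiffAt hz.1)]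
    at hhorizontal
  have hscalar := h.base.two_mul_ricci_eq hz.1 hE v w
  rw [hhorizontal] at hscalar
  have hne : φ z.1 ≠ 0 := h.ne_zero _ hz.1
  simp only [smul_apply, ContinuousLinearMap.id_apply, map_smul, smul_eq_mul]
  field_simp at hscalar ⊢
  linarith

lemma laplacian_eq (h : IsWarpedProductOn G φ K U V) (hz : z ∈ U ×ˢ V)
    (hflat : ∀ v w, ricci (warpedForm G φ K) z v w = 0) (hE : Module.finrank ℝ E = 2) :
    laplacian G φ z.1 = φ z.1 * scalar G z.1 / Module.finrank ℝ E' := by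
  rw [laplacian, h.covDerivGrad_eq_smul_id hz hflat hE, ContinuousLinearMap.toLinearMap_smul,
    map_smul, ContinuousLinearMap.coe_id, LinearMap.trace_id, hE]
  have hm : (Module.finrank ℝ E' : ℝ) ≠ 0 := mod_cast Module.finrank_pos.ne'
  simp only [smul_eq_mul, Nat.cast_ofNat]
  field_simp

lemma finrank_sub_one_mul_apply_grad_self (h : IsWarpedProductOn G φ K U V)
    (hz : z ∈ U ×ˢ V) (hflat : ∀ v w, ricci (warpedForm G φ K) z v w = 0)
    (hE : Module.finrank ℝ E = 2) (hscalar : scalar G z.1 = c * φ z.1) (ha : K z.2 a a ≠ 0) :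
    (Module.finrank ℝ E' - 1) * G z.1 (grad G φ z.1) (grad G φ z.1) =
      ricci K z.2 a a / K z.2 a a - c / Module.finrank ℝ E' * φ z.1 ^ 3 := by
  rw [h.ricci_fiber_eq hz hflat, h.laplacian_eq hz hflat hE, hscalar,
    mul_div_cancel_right₀ _ ha]
  ring

lemma mul_fderiv_eq_zero (h : IsWarpedProductOn G φ K U V) (hy : y ∈ U) (hx : x ∈ V)
    (hflat : ∀ z ∈ U ×ˢ V, ∀ v w, ricci (warpedForm G φ K) z v w = 0)
    (hE : Module.finrank ℝ E = 2) (hscalar : ∀ z ∈ U, scalar G z = c * φ z)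
    (ha : K x a a ≠ 0) (u : E) :
    c * fderiv ℝ φ y u = 0 := by
  have hgrad : (fun z ↦ (Module.finrank ℝ E' - 1) * G z (grad G φ z) (grad G φ z)) =ᶠ[𝓝 y]
      fun z ↦ ricci K x a a / K x a a - c / Module.finrank ℝ E' * φ z ^ 3 := by
    filter_upwards [h.base.mem_nhds hy] with z hz
    exact h.finrank_sub_one_mul_apply_grad_self (z := (z, x)) ⟨hz, hx⟩ (hflat _ ⟨hz, hx⟩) hE
      (hscalar z hz) ha
  have hleft := (h.base.hasFDerivAt_apply_grad_self hy (h.contDiffAt hy)).const_mul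
    (Module.finrank ℝ E' - 1 : ℝ)
  have hright := (((h.hasFDerivAt hy).pow 3).const_mul
    (c / Module.finrank ℝ E')).const_sub (ricci K x a a / K x a a)
  have hu := congr($(hleft.unique (hright.congr_of_eventuallyEq hgrad)) u)
  rw [h.covDerivGrad_eq_smul_id (z := (y, x)) ⟨hy, hx⟩ (hflat _ ⟨hy, hx⟩) hE, hscalar y hy,
    h.base.apply_grad hy] at hu
  simp only [smul_apply, neg_apply, ContinuousLinearMap.comp_apply, ContinuousLinearMap.id_apply,
    map_smul, smul_eq_mul, nsmul_eq_mul] at hu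
  have hm : (Module.finrank ℝ E' : ℝ) ≠ 0 := mod_cast Module.finrank_pos.ne'
  have hne : φ y ≠ 0 := h.ne_zero y hy
  push_cast at hu
  field_simp at hu
  have hmul : ((Module.finrank ℝ E' : ℝ) + 2) * (c * fderiv ℝ φ y u) = 0 := by
    linear_combination hu
  exact (mul_eq_zero.1 hmul).resolve_left (by positivity)

end Nontrivial

lemma fderiv_eq_zero (h : IsWarpedProductOn G φ K U V) (hy : y ∈ U) (hx : x ∈ V)
    (hflat : ∀ z ∈ U ×ˢ V, ∀ v w, ricci (warpedForm G φ K) z v w = 0)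
    (hE : Module.finrank ℝ E = 2) (hE' : 2 ≤ Module.finrank ℝ E')
    (hscalar : ∀ z ∈ U, scalar G z = c * φ z) (hpos : ∀ v ≠ 0, 0 < G y v v)
    (ha : 0 < K x a a) (hricci : ricci K x a a ≤ 0) : fderiv ℝ φ y = 0 := by
  have : Nontrivial E' := Module.nontrivial_of_finrank_pos (R := ℝ) (by lia)
  rcases eq_or_ne c 0 with rfl | hc
  · have hm : (0 : ℝ) < Module.finrank ℝ E' - 1 := by
      have : (2 : ℝ) ≤ Module.finrank ℝ E' := mod_cast hE'
      linarith
    have hnorm := h.finrank_sub_one_mul_apply_grad_self (z := (y, x)) ⟨hy, hx⟩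
      (hflat _ ⟨hy, hx⟩) hE (hscalar y hy) ha.ne'
    have hgrad : grad G φ y = 0 := by
      by_contra hne
      have hleft := mul_pos hm (hpos _ hne)
      have hright := div_nonpos_of_nonpos_of_nonneg hricci ha.le
      rw [hnorm, zero_div, zero_mul, sub_zero] at hleft
      exact hleft.not_ge hright
    rw [← h.base.apply_grad hy, hgrad, map_zero]
  · ext u
    exact (mul_eq_zero.1 (h.mul_fderiv_eq_zero hy hx hflat hE hscalar ha.ne' u)).resolve_left hc

lemma riemann_base_eq_zero (h : IsWarpedProductOn G φ K U V) (hz : z ∈ U ×ˢ V)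
    (hflat : ∀ v w, ricci (warpedForm G φ K) z v w = 0) (hE : Module.finrank ℝ E = 2)
    (hφ : ∀ y ∈ U, fderiv ℝ φ y = 0) (u v w : E) : riemann G z.1 u v w = 0 := by
  have hφ' : fderiv ℝ φ =ᶠ[𝓝 z.1] fun _ ↦ 0 :=
    Filter.eventuallyEq_of_mem (h.base.mem_nhds hz.1) hφ
  refine h.base.riemann_eq_zero_of_ricci_eq_zero hz.1 hE (fun v w ↦ ?_) u v w
  simpa [hessian, hφ'.fderiv_eq, hφ z.1 hz.1, hflat] using (h.ricci_horizontal hz v w).symm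

end IsWarpedProductOn

end ProportionalScalarCurvature

section Charts

variable {E : Type*} [NormedAddCommGroup E] [NormedSpace ℝ E]
  {H : Type*} [TopologicalSpace H] {I : ModelWithCorners ℝ E H}
  {M : Type*} [TopologicalSpace M] [ChartedSpace H M]
  {e : OpenPartialHomeomorph M H} {y : E}

lemma contMDiffOn_extend_symm_target [IsManifold I ∞ M] (he : e ∈ atlas H M) :
    ContMDiffOn 𝓘(ℝ, E) I ∞ (e.extend I).symm (e.extend I).target := by
  rw [e.extend_target']
  exact contMDiffOn_extend_symm (IsManifold.subset_maximalAtlas he)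

lemma inChart_apply (g : FormField I M) (e : OpenPartialHomeomorph M H) (y v w : E) :
    inChart g e y v w = g ((e.extend I).symm y) (mfderiv 𝓘(ℝ, E) I (e.extend I).symm y v)
      (mfderiv 𝓘(ℝ, E) I (e.extend I).symm y w) := rfl

lemma isLocallyConstant_of_fderiv_comp_extend_symm_eq_zero [I.Boundaryless] {X : Type*}
    [NormedAddCommGroup X] [NormedSpace ℝ X] {f : M → X}
    (hf : ∀ e ∈ atlas H M, DifferentiableOn ℝ (f ∘ (e.extend I).symm) (e.extend I).target)
    (hf' : ∀ e ∈ atlas H M, ∀ y ∈ (e.extend I).target,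
      fderiv ℝ (f ∘ (e.extend I).symm) y = 0) : IsLocallyConstant f := by
  refine IsLocallyConstant.iff_eventually_eq f |>.2 fun x ↦ ?_
  let e := chartAt H x
  have he : e ∈ atlas H M := chart_mem_atlas H x
  have hx : x ∈ e.source := mem_chart_source H x
  have hopen := (e.isOpen_extend_target (I := I)).isOpen_inter_preimage_of_fderiv_eq_zero (hf e he)
    (hf' e he) {f x}
  have hleft (x' : M) (hx' : x' ∈ e.source) : (f ∘ (e.extend I).symm) (e.extend I x') = f x' :=
    congrArg f (e.extend_left_inv hx')
  have hmem : e.extend I x ∈ (e.extend I).target ∩ (f ∘ (e.extend I).symm) ⁻¹' {f x} :=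
    ⟨(e.extend I).map_source (by rwa [e.extend_source]), hleft x hx⟩
  filter_upwards [e.continuousAt_extend hx (hopen.mem_nhds hmem), e.open_source.mem_nhds hx]
    with x' hx' hsource
  exact (hleft x' hsource).symm.trans hx'.2

section Boundaryless

variable [IsManifold I ∞ M] [I.Boundaryless]

lemma mdifferentiableAt_extend_symm (he : e ∈ atlas H M) (hy : y ∈ (e.extend I).target) :
    MDifferentiableAt 𝓘(ℝ, E) I (e.extend I).symm y :=
  ((contMDiffOn_extend_symm_target he).contMDiffAt
    (e.isOpen_extend_target.mem_nhds hy)).mdifferentiableAt (by simp)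

lemma mfderiv_extend_symm_injective (he : e ∈ atlas H M) (hy : y ∈ (e.extend I).target) :
    Function.Injective (mfderiv 𝓘(ℝ, E) I (e.extend I).symm y) := by
  have hsource : (e.extend I).symm y ∈ e.source := e.extend_source (I := I) ▸
    (e.extend I).map_target hy
  have hextend : MDifferentiableAt I 𝓘(ℝ, E) (e.extend I) ((e.extend I).symm y) :=
    ((e.contMDiffOn_extend (IsManifold.subset_maximalAtlas (n := ∞) he)).contMDiffAt
      (e.open_source.mem_nhds hsource)).mdifferentiableAt (by simp)
  have hid : e.extend I ∘ (e.extend I).symm =ᶠ[𝓝 y] id :=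
    Filter.eventuallyEq_of_mem (e.isOpen_extend_target.mem_nhds hy)
      fun _ hz ↦ (e.extend I).right_inv hz
  have hcomp := mfderiv_comp y hextend (mdifferentiableAt_extend_symm he hy)
  rw [hid.mfderiv_eq, mfderiv_id] at hcomp
  exact Function.LeftInverse.injective (g := mfderiv I 𝓘(ℝ, E) (e.extend I) ((e.extend I).symm y))
    fun v ↦ congr($hcomp v).symm

lemma contMDiffOn_mfderiv_extend_symm (he : e ∈ atlas H M) (v : E) :
    ContMDiffOn 𝓘(ℝ, E) I.tangent ∞
      (fun y ↦ (⟨(e.extend I).symm y, mfderiv 𝓘(ℝ, E) I (e.extend I).symm y v⟩ :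
        TangentBundle I M)) (e.extend I).target := by
  have hopen := e.isOpen_extend_target (I := I)
  have : IsManifold I 1 M := IsManifold.of_le (n := ∞) (by simp)
  have htangent := (contMDiffOn_extend_symm_target (I := I) he).contMDiffOn_tangentMapWithin
    (m := ∞) le_rfl hopen.uniqueMDiffOn
  have hconst : ContMDiff 𝓘(ℝ, E) 𝓘(ℝ, E).tangent ∞
      (fun y ↦ (⟨y, v⟩ : TangentBundle 𝓘(ℝ, E) E)) :=
    contMDiff_vectorSpace_iff_contDiff.2 contDiff_const
  refine (htangent.comp hconst.contMDiffOn fun y hy ↦ hy).congr fun y hy ↦ ?_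
  simp only [Function.comp_apply, tangentMapWithin, mfderivWithin_of_isOpen hopen hy]

lemma contDiffOn_inChart_apply
    (g : Bundle.ContMDiffRiemannianMetric I ∞ E (fun x : M ↦ TangentSpace I x))
    (he : e ∈ atlas H M) (v w : E) :
    ContDiffOn ℝ ∞ (fun y ↦ inChart g.inner e y v w) (e.extend I).target := by
  let : Bundle.RiemannianBundle (fun x : M ↦ TangentSpace I x) := ⟨g.toRiemannianMetric⟩
  have h := ContMDiffOn.inner_bundle (IB := I) (F := E) (E := fun x : M ↦ TangentSpace I x)
    (contMDiffOn_mfderiv_extend_symm he v) (contMDiffOn_mfderiv_extend_symm he w)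
  exact contMDiffOn_iff_contDiffOn.1 h

lemma inChart_pos (g : Bundle.ContMDiffRiemannianMetric I ∞ E (fun x : M ↦ TangentSpace I x))
    (he : e ∈ atlas H M) (hy : y ∈ (e.extend I).target) {v : E} (hv : v ≠ 0) :
    0 < inChart g.inner e y v v := by
  rw [inChart_apply]
  refine g.pos _ _ fun h ↦ hv (mfderiv_extend_symm_injective he hy ?_)
  exact h.trans (map_zero _).symm

lemma isPseudoRiemannianOn_inChart [FiniteDimensional ℝ E]
    (g : Bundle.ContMDiffRiemannianMetric I ∞ E (fun x : M ↦ TangentSpace I x))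
    (he : e ∈ atlas H M) : IsPseudoRiemannianOn (inChart g.inner e) (e.extend I).target where
  isOpen := e.isOpen_extend_target
  contDiffOn := contDiffOn_clm_apply.2 fun v ↦ contDiffOn_clm_apply.2 fun w ↦
    contDiffOn_inChart_apply g he v w
  symm _ _ _ _ := by rw [inChart_apply, inChart_apply, g.symm]
  isInvertible _ hy := isInvertible_of_pos fun _ hv ↦ inChart_pos g he hy hv

end Boundaryless

end Charts

section ProductChart

variable {E : Type*} [NormedAddCommGroup E] [NormedSpace ℝ E]
  {H : Type*} [TopologicalSpace H] {I : ModelWithCorners ℝ E H} [I.Boundaryless]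
  {B : Type*} [TopologicalSpace B] [ChartedSpace H B] [IsManifold I ∞ B]
  {E' : Type*} [NormedAddCommGroup E'] [NormedSpace ℝ E']
  {H' : Type*} [TopologicalSpace H'] {J : ModelWithCorners ℝ E' H'} [J.Boundaryless]
  {F : Type*} [TopologicalSpace F] [ChartedSpace H' F] [IsManifold J ∞ F]
  {e : OpenPartialHomeomorph B H} {e' : OpenPartialHomeomorph F H'} {z : E × E'}

lemma mdifferentiableAt_extend_prod_symm (he : e ∈ atlas H B) (he' : e' ∈ atlas H' F)
    (hz : z ∈ (e.extend I).target ×ˢ (e'.extend J).target) :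
    MDifferentiableAt 𝓘(ℝ, E × E') (I.prod J) ((e.prod e').extend (I.prod J)).symm z :=
  mdifferentiableAt_extend_symm (Set.mem_image2_of_mem he he')
    (by rwa [OpenPartialHomeomorph.extend_prod])

lemma mfderiv_fst_mfderiv_extend_prod_symm (he : e ∈ atlas H B) (he' : e' ∈ atlas H' F)
    (hz : z ∈ (e.extend I).target ×ˢ (e'.extend J).target) (v : E × E') :
    mfderiv (I.prod J) I Prod.fst (((e.prod e').extend (I.prod J)).symm z)
      (mfderiv 𝓘(ℝ, E × E') (I.prod J) ((e.prod e').extend (I.prod J)).symm z v) =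
    mfderiv 𝓘(ℝ, E) I (e.extend I).symm z.1 v.1 := by
  have hleft := mfderiv_comp z (mdifferentiableAt_fst (I := I) (I' := J))
    (mdifferentiableAt_extend_prod_symm he he' hz)
  have hright := mfderiv_comp (I := 𝓘(ℝ, E × E')) z (mdifferentiableAt_extend_symm he hz.1)
    (differentiableAt_fst (𝕜 := ℝ)).mdifferentiableAt
  rw [mfderiv_eq_fderiv, fderiv_fst] at hright
  exact congr($(hleft.symm.trans hright) v)

lemma mfderiv_snd_mfderiv_extend_prod_symm (he : e ∈ atlas H B) (he' : e' ∈ atlas H' F)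
    (hz : z ∈ (e.extend I).target ×ˢ (e'.extend J).target) (v : E × E') :
    mfderiv (I.prod J) J Prod.snd (((e.prod e').extend (I.prod J)).symm z)
      (mfderiv 𝓘(ℝ, E × E') (I.prod J) ((e.prod e').extend (I.prod J)).symm z v) =
    mfderiv 𝓘(ℝ, E') J (e'.extend J).symm z.2 v.2 := by
  have hleft := mfderiv_comp z (mdifferentiableAt_snd (I := I) (I' := J))
    (mdifferentiableAt_extend_prod_symm he he' hz)
  have hright := mfderiv_comp (I := 𝓘(ℝ, E × E')) z (mdifferentiableAt_extend_symm he' hz.2)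
    (differentiableAt_snd (𝕜 := ℝ)).mdifferentiableAt
  rw [mfderiv_eq_fderiv, fderiv_snd] at hright
  exact congr($(hleft.symm.trans hright) v)

lemma inChart_warped (g : FormField I B) (f : B → ℝ) (k : FormField J F) (he : e ∈ atlas H B)
    (he' : e' ∈ atlas H' F) (hz : z ∈ (e.extend I).target ×ˢ (e'.extend J).target) :
    inChart (warped g f k) (e.prod e') z =
      warpedForm (inChart g e) (f ∘ (e.extend I).symm) (inChart k e') z := by
  refine ContinuousLinearMap.ext fun v ↦ ContinuousLinearMap.ext fun w ↦ ?_
  rw [warpedForm_apply, inChart_apply, inChart_apply, inChart_apply,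
    ← mfderiv_fst_mfderiv_extend_prod_symm he he' hz v,
    ← mfderiv_fst_mfderiv_extend_prod_symm he he' hz w,
    ← mfderiv_snd_mfderiv_extend_prod_symm he he' hz v,
    ← mfderiv_snd_mfderiv_extend_prod_symm he he' hz w]
  rfl

variable [FiniteDimensional ℝ E] [FiniteDimensional ℝ E']

lemma IsRicciFlat.ricci_warpedForm_eq_zero {g : FormField I B} {f : B → ℝ} {k : FormField J F}
    (h : IsRicciFlat (warped g f k)) (he : e ∈ atlas H B) (he' : e' ∈ atlas H' F)
    (hz : z ∈ (e.extend I).target ×ˢ (e'.extend J).target) (v w : E × E') :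
    ricci (warpedForm (inChart g e) (f ∘ (e.extend I).symm) (inChart k e')) z v w = 0 := by
  have hopen := (e.isOpen_extend_target (I := I)).prod (e'.isOpen_extend_target (I := J))
  rw [← ricci_congr (Filter.eventuallyEq_of_mem (hopen.mem_nhds hz)
    fun _ hx ↦ inChart_warped g f k he he' hx)]
  exact h _ (Set.mem_image2_of_mem he he') z (by rwa [OpenPartialHomeomorph.extend_prod]) v w

lemma isWarpedProductOn_inChart
    (g : Bundle.ContMDiffRiemannianMetric I ∞ E (fun x : B ↦ TangentSpace I x))
    (k : Bundle.ContMDiffRiemannianMetric J ∞ E' (fun x : F ↦ TangentSpace J x))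
    {f : B → ℝ} (hf : ContMDiff I 𝓘(ℝ, ℝ) ∞ f) (hf0 : ∀ x, f x ≠ 0)
    (he : e ∈ atlas H B) (he' : e' ∈ atlas H' F) :
    IsWarpedProductOn (inChart g.inner e) (f ∘ (e.extend I).symm) (inChart k.inner e')
      (e.extend I).target (e'.extend J).target where
  base := isPseudoRiemannianOn_inChart g he
  fiber := isPseudoRiemannianOn_inChart k he'
  contDiffOn := contMDiffOn_iff_contDiffOn.1
    (hf.comp_contMDiffOn (contMDiffOn_extend_symm_target he))
  ne_zero _ _ := hf0 _

end ProductChart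

end WarpedSurface

end

theorem theorem1_general
    {E : Type*} [NormedAddCommGroup E] [NormedSpace ℝ E] [FiniteDimensional ℝ E]
    {H : Type*} [TopologicalSpace H] {I : ModelWithCorners ℝ E H} [I.Boundaryless]
    {B : Type*} [TopologicalSpace B] [ChartedSpace H B] [IsManifold I ∞ B] [PreconnectedSpace B]
    {E' : Type*} [NormedAddCommGroup E'] [NormedSpace ℝ E'] [FiniteDimensional ℝ E']
    {H' : Type*} [TopologicalSpace H'] {J : ModelWithCorners ℝ E' H'} [J.Boundaryless]
    {F : Type*} [TopologicalSpace F] [ChartedSpace H' F] [IsManifold J ∞ F]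
    (g : Bundle.ContMDiffRiemannianMetric I ∞ E (fun x : B ↦ TangentSpace I x))
    (k : Bundle.ContMDiffRiemannianMetric J ∞ E' (fun x : F ↦ TangentSpace J x))
    (f : B → ℝ) (hf : ContMDiff I 𝓘(ℝ, ℝ) ∞ f) (hf0 : ∀ x, f x ≠ 0)
    (hE : Module.finrank ℝ E = 2) (hE' : 2 ≤ Module.finrank ℝ E')
    (c : ℝ) (hR : WarpedSurface.HasScalarCurvature g.inner (fun x ↦ c * f x))
    (hF : ∃ e' ∈ atlas H' F, ∃ x ∈ (e'.extend J).target, ∃ a ≠ 0,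
      WarpedSurface.ricci (WarpedSurface.inChart k.inner e') x a a ≤ 0)
    (hM : WarpedSurface.IsRicciFlat (WarpedSurface.warped g.inner f k.inner)) :
    (∃ a : ℝ, ∀ x, f x = a) ∧ WarpedSurface.IsFlat g.inner := by
  obtain ⟨e', he', x, hx, a, ha, hricci⟩ := hF
  have hW (e) (he : e ∈ atlas H B) := WarpedSurface.isWarpedProductOn_inChart g k hf hf0 he he'
  have hconst : ∀ e ∈ atlas H B, ∀ y ∈ (e.extend I).target,
      fderiv ℝ (f ∘ (e.extend I).symm) y = 0 := fun e he y hy ↦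
    (hW e he).fderiv_eq_zero hy hx (fun _ hz ↦ hM.ricci_warpedForm_eq_zero he he' hz) hE hE'
      (hR e he) (fun _ hv ↦ WarpedSurface.inChart_pos g he hy hv)
      (WarpedSurface.inChart_pos k he' hx ha) hricci
  constructor
  · obtain ⟨b, rfl⟩ := (WarpedSurface.isLocallyConstant_of_fderiv_comp_extend_symm_eq_zero
      (fun e he ↦ (hW e he).contDiffOn.differentiableOn (by simp)) hconst).exists_eq_const
    exact ⟨b, fun _ ↦ rfl⟩
  · exact fun e he y hy ↦ (hW e he).riemann_base_eq_zero (z := (y, x)) ⟨hy, hx⟩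
      (hM.ricci_warpedForm_eq_zero he he' ⟨hy, hx⟩) hE (hconst e he)

theorem theorem1
    {B : Type*} [TopologicalSpace B] [ChartedSpace (EuclideanSpace ℝ (Fin 2)) B]
    [IsManifold (𝓡 2) ∞ B] [ConnectedSpace B]
    {F : Type*} [TopologicalSpace F] [ChartedSpace (EuclideanSpace ℝ (Fin 2)) F]
    [IsManifold (𝓡 2) ∞ F] [Nonempty F]
    (g : Bundle.ContMDiffRiemannianMetric (𝓡 2) ∞ (EuclideanSpace ℝ (Fin 2))
      (fun x : B => TangentSpace (𝓡 2) x))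
    (k : Bundle.ContMDiffRiemannianMetric (𝓡 2) ∞ (EuclideanSpace ℝ (Fin 2))
      (fun x : F => TangentSpace (𝓡 2) x))
    (f : B → ℝ) (hf : ContMDiff (𝓡 2) 𝓘(ℝ, ℝ) ∞ f) (hf_pos : ∀ x, 0 < f x)
    (c : ℝ) (hR : WarpedSurface.HasScalarCurvature g.inner (fun x => c * f x))
    (hF : WarpedSurface.IsRicciFlat k.inner)
    (hM : WarpedSurface.IsRicciFlat (WarpedSurface.warped g.inner f k.inner)) :
    (∃ a : ℝ, ∀ x, f x = a) ∧ WarpedSurface.IsFlat g.inner := by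
  obtain ⟨p⟩ := ‹Nonempty F›
  obtain ⟨a, ha⟩ := exists_ne (0 : EuclideanSpace ℝ (Fin 2))
  have he' := chart_mem_atlas (EuclideanSpace ℝ (Fin 2)) p
  have hp := mem_extChartAt_target (I := 𝓡 2) p
  exact theorem1_general g k f hf (fun x ↦ (hf_pos x).ne') (by simp) (by simp) c hR
    ⟨_, he', _, hp, a, ha, (hF _ he' _ hp a a).le⟩ hM
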